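/- A (finite) hypergraph $H=(V,E)$ consists of a finite set $V$ of vertices and a finite multiset $E$ of edges, each of which is a subset of $V$ (parallel edges are allowed). It is $r$-uniform if every edge has exactly $r$ vertices, $t$-regular if every vertex is incident to exactly $t$ edges, and $r$-partite if $V$ can be partitioned into $r$ pairwise disjoint parts $V_1,\dots,V_r$ such that $|e\cap V_i|\le 1$ for every edge $e$ and every $i$. A cycle of length $k\ge 2$ is a sequence $v_1e_1v_2e_2\dots v_ke_kv_{k+1}$ with $v_1,\dots,v_k$ distinct vertices, $e_1,\dots,e_k$ distinct edges, $v_{k+1}=v_1$, and $\{v_i,v_{i+1}\}\subseteq e_i$ for $i=1,\dots,k$; the girth of $H$ is the smallest length of a cycle in $H$ ($\infty$ if there is none). A set $M\subseteq E$ of edges is hitting if every vertex is incident to at least one edge of $M$, and it is $s$-shallow if every vertex is incident to at most $s$ edges of $M$. **Corollary.** For every integer $t\ge 2$, let $r=\lceil t\,2^{t-1}\ln 2\rceil$. Then there exists an $r$-uniform $r$-partite $t$-regular hypergraph of girth at least four that has no $(t-1)$-shallow hitting edge set. -/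

import Mathlib

/-- A hypergraph on the vertex type `V` whose multiset of edges is indexed by `E`: every `e : E`
is an edge, with vertex set `H.edge e`. Parallel edges are different indices `e ≠ e'` with
`H.edge e = H.edge e'`. The hypergraph is finite when `V` and `E` are finite. -/
structure MultiHypergraph (V E : Type*) where
  /-- the set of vertices of an edge -/
  edge : E → Finset V

namespace MultiHypergraph

variable {V E : Type*}

open Classical in
/-- The degree of the vertex `v` in the edge set `M`: the number of edges in `M` incident to `v`. -/
noncomputable def degreeIn (H : MultiHypergraph V E) (M : Finset E) (v : V) : ℕ :=
  (M.filter (fun e => v ∈ H.edge e)).card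

/-- The degree of the vertex `v`: the number of all edges incident to `v`. -/
noncomputable def degree [Fintype E] (H : MultiHypergraph V E) (v : V) : ℕ :=
  H.degreeIn Finset.univ v

/-- Every edge has exactly `r` vertices. -/
def IsUniform (H : MultiHypergraph V E) (r : ℕ) : Prop :=
  ∀ e : E, (H.edge e).card = r

/-- Every vertex has degree `d`. -/
def IsRegular [Fintype E] (H : MultiHypergraph V E) (d : ℕ) : Prop :=
  ∀ v : V, H.degree v = d

open Classical in
/-- The vertices can be partitioned into `r` pairwise disjoint parts such that every edge has at
most one vertex in each part. -/
def IsPartite (H : MultiHypergraph V E) (r : ℕ) : Prop :=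
  ∃ P : Fin r → Finset V,
    (∀ i j : Fin r, i ≠ j → Disjoint (P i) (P j)) ∧
    (∀ v : V, ∃ i : Fin r, v ∈ P i) ∧
    ∀ (e : E) (i : Fin r), (H.edge e ∩ P i).card ≤ 1

/-- There is a cycle of length `k ≥ 2`: a sequence `v₀ e₀ v₁ e₁ … e_{k-1} v_k` with `v_k = v₀`,
with `v₀, …, v_{k-1}` distinct, with `e₀, …, e_{k-1}` distinct (as indices, so that two parallel
edges count as distinct), and with `v_i` and `v_{i+1}` both in `e_i`. -/
def HasCycle (H : MultiHypergraph V E) (k : ℕ) : Prop :=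
  2 ≤ k ∧ ∃ (v : Fin (k + 1) → V) (e : Fin k → E),
    Function.Injective (fun i : Fin k => v i.castSucc) ∧
    Function.Injective e ∧
    v (Fin.last k) = v 0 ∧
    ∀ i : Fin k, v i.castSucc ∈ H.edge (e i) ∧ v i.succ ∈ H.edge (e i)

/-- The girth: the smallest length of a cycle, and `⊤` if there is no cycle. -/
noncomputable def girth (H : MultiHypergraph V E) : ℕ∞ :=
  ⨅ (k : ℕ) (_ : H.HasCycle k), (k : ℕ∞)

/-- The edge set `M` is hitting: every vertex is incident to at least one edge of `M`. -/
def IsHitting (H : MultiHypergraph V E) (M : Finset E) : Prop :=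
  ∀ v : V, 1 ≤ H.degreeIn M v

/-- The edge set `M` is `s`-shallow: every vertex is incident to at most `s` edges of `M`. -/
def IsShallow (H : MultiHypergraph V E) (s : ℕ) (M : Finset E) : Prop :=
  ∀ v : V, H.degreeIn M v ≤ s

end MultiHypergraph

open scoped Finset

/-! Dualise: the hyperedges become a set X of N = mt points, and the vertices of part i become the m
blocks, of size t, of an i-th partition of X. A (t-1)-shallow hitting set is then a 2-colouring of X
that is nonconstant on every block of all r partitions.

For a random partition, a fixed colouring is nonconstant on all m blocks with probability at most
(N+1)(1 - 2^(1-t))^m (`card_perm_blocksBichromatic_le`). Against 2^(mt) colourings and r partitions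
the exponential base is 2^t (1 - 2^(1-t))^r, which is below 1 for this r, so polynomial factors are
harmless once m is large.

The girth condition restricts the randomness only mildly. Call two points conflicting if two blocks
of earlier partitions link them; each point has at most D = (rt)^2 conflicts. So X splits into tD+1
conflict-free classes, each a union of blocks (`exists_equiv_independent_classes`). Shuffling points
only inside classes creates no short cycle and costs one factor N+1 per class (`exists_block_map`).
Partitions are picked one at a time, each retaining at most an average share of the surviving
colourings (`exists_isBlockSystem`). -/

/-! ### Random permutations of a fixed colouring -/

/-- The Poisson weight a^b / b! is largest at b = a. -/
theorem factorial_mul_pow_le_factorial_mul_pow_self (a b : ℕ) :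
    a.factorial * a ^ b ≤ b.factorial * a ^ a := by
  rcases le_total a b with h | h
  · calc a.factorial * a ^ b = a.factorial * a ^ (b - a) * a ^ a := by
          rw [mul_assoc, ← pow_add, Nat.sub_add_cancel h]
      _ ≤ b.factorial * a ^ a :=
          Nat.mul_le_mul_right _ (Nat.factorial_mul_pow_sub_le_factorial h)
  · have h1 : a.factorial ≤ b.factorial * a ^ (a - b) := by
      have := Nat.factorial_mul_descFactorial (n := a) (k := a - b) (Nat.sub_le _ _)
      rw [Nat.sub_sub_self h] at this
      rw [← this]
      exact Nat.mul_le_mul_left _ (Nat.descFactorial_le_pow _ _)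
    calc a.factorial * a ^ b ≤ b.factorial * a ^ (a - b) * a ^ b := Nat.mul_le_mul_right _ h1
      _ = b.factorial * a ^ a := by rw [mul_assoc, ← pow_add, Nat.sub_add_cancel h]

/-- The mode of the binomial distribution with mean `a` has weight at least `1 / (a + d + 1)`. -/
theorem factorial_mul_factorial_mul_pow_le (a d : ℕ) :
    a.factorial * d.factorial * (a + d) ^ (a + d) ≤
      (a + d + 1) * ((a + d).factorial * a ^ a * d ^ d) := by
  -- Each of the a+d+1 terms of the binomial expansion is at most the term b = a.
  rw [add_pow, Finset.mul_sum]
  refine (Finset.sum_le_card_nsmul _ _ ((a + d).factorial * a ^ a * d ^ d) ?_).trans ?_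
  · intro b hb
    have hb' : b ≤ a + d := Nat.lt_succ_iff.mp (Finset.mem_range.mp hb)
    calc a.factorial * d.factorial * (a ^ b * d ^ (a + d - b) * ((a + d).choose b))
        = (a.factorial * a ^ b) * (d.factorial * d ^ (a + d - b)) * (a + d).choose b := by ring
      _ ≤ (b.factorial * a ^ a) * ((a + d - b).factorial * d ^ d) * (a + d).choose b := by
          gcongr ?_ * ?_ * _ <;> exact factorial_mul_pow_le_factorial_mul_pow_self _ _
      _ = ((a + d).choose b * b.factorial * (a + d - b).factorial) * a ^ a * d ^ d := by ring
      _ = _ := by rw [Nat.choose_mul_factorial_mul_factorial hb']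
  · simp

/-- The colouring `c` is nonconstant on every block `{j} × Fin t`. -/
def BlocksBichromatic {J : Type*} {t : ℕ} (c : J × Fin t → Bool) : Prop :=
  ∀ j, ∃ s s', c (j, s) ≠ c (j, s')

open Classical in
-- Independent bits with bias p all agree with probability p^t + (1-p)^t, which by convexity is
-- least at p = 1/2.
theorem sum_prod_nonconstant {t : ℕ} (ht : 1 ≤ t) (w : Bool → ℝ) (hw : ∀ b, 0 ≤ w b)
    (h1 : w true + w false = 1) :
    ∑ d : Fin t → Bool with (∃ s s', d s ≠ d s'), ∏ s, w (d s) ≤ 1 - 1 / 2 ^ (t - 1) := by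
  have htot : ∑ d : Fin t → Bool, ∏ s, w (d s) = 1 := by
    rw [← Fintype.piFinset_univ, ← Finset.prod_univ_sum]
    simp [h1]
  have hsplit := Finset.sum_filter_add_sum_filter_not Finset.univ
    (fun d : Fin t → Bool => ∃ s s', d s ≠ d s') (fun d => ∏ s, w (d s))
  rw [htot] at hsplit
  have hne : (fun _ : Fin t => true) ≠ fun _ => false := by
    intro h
    simpa using congrFun h ⟨0, ht⟩
  have hge : w true ^ t + w false ^ t ≤
      ∑ d : Fin t → Bool with ¬ (∃ s s', d s ≠ d s'), ∏ s, w (d s) := by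
    have : ∑ d ∈ ({fun _ => true, fun _ => false} : Finset (Fin t → Bool)), ∏ s, w (d s)
        = w true ^ t + w false ^ t := by
      rw [Finset.sum_pair hne]; simp
    rw [← this]
    refine Finset.sum_le_sum_of_subset_of_nonneg ?_ fun d _ _ => Finset.prod_nonneg fun s _ => hw _
    intro d hd
    simp only [Finset.mem_insert, Finset.mem_singleton] at hd
    rcases hd with rfl | rfl <;> simp
  have hpm := add_pow_le (hw true) (hw false) t
  rw [h1, one_pow] at hpm
  have : 1 / 2 ^ (t - 1) ≤ w true ^ t + w false ^ t := by
    rw [div_le_iff₀ (by positivity)]; linarith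
  linarith

open Classical in
theorem sum_prod_blocksBichromatic {J : Type*} [Fintype J] {t : ℕ} (ht : 1 ≤ t) (w : Bool → ℝ)
    (hw : ∀ b, 0 ≤ w b) (h1 : w true + w false = 1) :
    ∑ c : J × Fin t → Bool with BlocksBichromatic c, ∏ y, w (c y)
      ≤ (1 - 1 / 2 ^ (t - 1)) ^ Fintype.card J := by
  have : ∑ c : J × Fin t → Bool with BlocksBichromatic c, ∏ y, w (c y) =
      ∏ _j : J, ∑ d : Fin t → Bool with (∃ s s', d s ≠ d s'), ∏ s, w (d s) := by
    rw [Finset.prod_univ_sum]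
    refine Finset.sum_bij' (fun c _ => Function.curry c) (fun c _ => Function.uncurry c)
      ?_ ?_ ?_ ?_ ?_
    · intro c hc
      rw [Fintype.mem_piFinset]
      exact fun j => Finset.mem_filter.mpr
        ⟨Finset.mem_univ _, (Finset.mem_filter.mp hc).2 j⟩
    · intro c hc
      rw [Fintype.mem_piFinset] at hc
      exact Finset.mem_filter.mpr
        ⟨Finset.mem_univ _, fun j => (Finset.mem_filter.mp (hc j)).2⟩
    · intro c _; simp
    · intro c _; simp
    · intro c _
      rw [Fintype.prod_prod_type]
      rfl
  rw [this, Finset.prod_const, Finset.card_univ]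
  exact pow_le_pow_left₀
    (Finset.sum_nonneg fun d _ => Finset.prod_nonneg fun s _ => hw _)
    (sum_prod_nonconstant ht w hw h1) _

open Classical in
-- A nonempty fibre is a coset of the stabiliser of `c`.
theorem card_perm_comp_eq_le {Y : Type*} [Fintype Y] [DecidableEq Y] (c c' : Y → Bool) :
    #{σ : Equiv.Perm Y | c ∘ σ = c'} ≤
      (#{y | c y = true}).factorial * (#{y | c y = false}).factorial := by
  rcases Finset.eq_empty_or_nonempty ({σ : Equiv.Perm Y | c ∘ σ = c'} : Finset _) with h | ⟨τ, hτ⟩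
  · simp [h]
  · have hτ' : c ∘ τ = c' := by simpa using hτ
    have hst := DomMulAct.stabilizer_card c
    rw [Fintype.card_subtype, Fintype.prod_bool, Fintype.card_subtype, Fintype.card_subtype] at hst
    rw [← hst]
    refine Finset.card_le_card_of_injOn (fun σ => σ * τ⁻¹) ?_ ?_
    · intro σ hσ
      have hσ' : c ∘ σ = c' := by simpa using hσ
      simp only [Finset.coe_filter, Finset.mem_univ, true_and, Set.mem_ofPred_eq]
      ext y
      have := congrFun (hσ'.trans hτ'.symm) (τ⁻¹ y)
      simpa using this
    · intro σ _ σ' _ h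
      simpa using h

open Classical in
/-- A uniformly random permutation makes a fixed colouring bichromatic on all blocks with
exponentially small probability. -/
theorem card_perm_blocksBichromatic_le {J : Type*} [Fintype J] [DecidableEq J] {t : ℕ}
    (ht : 1 ≤ t)
    (c : J × Fin t → Bool) :
    (#{σ : Equiv.Perm (J × Fin t) | BlocksBichromatic (c ∘ σ)} : ℝ) ≤
      (Fintype.card (J × Fin t) + 1) * (1 - 1 / 2 ^ (t - 1)) ^ Fintype.card J *
        Fintype.card (Equiv.Perm (J × Fin t)) := by
  set N := Fintype.card (J × Fin t) with hN
  set a := #{y | c y = true} with ha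
  set d := #{y | c y = false} with hd
  have had : a + d = N := by
    rw [hN, ← Finset.card_univ, ← Finset.card_filter_add_card_filter_not (fun y => c y = true)]
    simp [ha, hd]
  rcases Nat.eq_zero_or_pos N with h0 | hpos
  · have hJ : Fintype.card J = 0 := by
      rw [hN, Fintype.card_prod, Fintype.card_fin] at h0
      rcases Nat.mul_eq_zero.mp h0 with h | h <;> omega
    rw [h0, hJ]
    simp only [Nat.cast_zero, zero_add, pow_zero, one_mul]
    exact_mod_cast Finset.card_le_univ _
  -- Compare with independent bits of the same bias as `c`: all rearrangements of `c` have equal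
  -- weight, and together they carry mass at least 1/(N+1) by the mode estimate.
  let w : Bool → ℝ := fun b => if b then (a : ℝ) / N else (d : ℝ) / N
  have hNR : (0 : ℝ) < N := by exact_mod_cast hpos
  have hw : ∀ b, 0 ≤ w b := by intro b; cases b <;> simp only [w] <;> positivity
  have h1 : w true + w false = 1 := by
    simp only [w, if_true, Bool.false_eq_true, if_false]
    rw [← add_div, div_eq_one_iff_eq hNR.ne']
    exact_mod_cast had
  set Q : Finset (J × Fin t → Bool) :=
    {c' | BlocksBichromatic c' ∧ ∃ σ : Equiv.Perm (J × Fin t), c ∘ σ = c'} with hQ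
  have hcount : #{σ : Equiv.Perm (J × Fin t) | BlocksBichromatic (c ∘ σ)} ≤
      #Q * (a.factorial * d.factorial) := by
    rw [Finset.card_eq_sum_card_fiberwise (f := fun σ : Equiv.Perm (J × Fin t) => c ∘ σ) (t := Q)]
    · rw [← smul_eq_mul]
      refine Finset.sum_le_card_nsmul _ _ _ fun c' _ => ?_
      refine le_trans (Finset.card_le_card ?_) (card_perm_comp_eq_le c c')
      intro σ hσ
      simp only [Finset.mem_filter, Finset.mem_univ, true_and] at hσ ⊢
      exact hσ.2
    · intro σ hσ
      simp only [Finset.coe_filter, Finset.mem_univ, true_and, Set.mem_ofPred_eq, hQ] at hσ ⊢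
      exact ⟨hσ, σ, rfl⟩
  have hweight : (#Q : ℝ) * ((a / N : ℝ) ^ a * (d / N : ℝ) ^ d) ≤
      (1 - 1 / 2 ^ (t - 1)) ^ Fintype.card J := by
    refine le_trans ?_ (sum_prod_blocksBichromatic (J := J) ht w hw h1)
    have hval : ∀ c' ∈ Q, ∏ y, w (c' y) = (a / N : ℝ) ^ a * (d / N : ℝ) ^ d := by
      intro c' hc'
      obtain ⟨σ, rfl⟩ := (Finset.mem_filter.mp hc').2.2
      simp only [Function.comp]
      rw [Equiv.prod_comp σ (fun y => w (c y))]
      simp only [w]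
      rw [Finset.prod_ite, Finset.prod_const, Finset.prod_const]
      simp only [Bool.not_eq_true, ← ha, ← hd]
    rw [← nsmul_eq_mul, ← Finset.sum_const, ← Finset.sum_congr rfl hval]
    refine Finset.sum_le_sum_of_subset_of_nonneg ?_
      fun c' _ _ => Finset.prod_nonneg fun s _ => hw _
    intro c' hc'
    simp only [hQ, Finset.mem_filter, Finset.mem_univ, true_and] at hc' ⊢
    exact hc'.1
  have hmode : ((a.factorial * d.factorial : ℕ) : ℝ) ≤
      (N + 1) * N.factorial * ((a / N : ℝ) ^ a * (d / N : ℝ) ^ d) := by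
    have := factorial_mul_factorial_mul_pow_le a d
    rw [had] at this
    have h2 : (a.factorial * d.factorial : ℝ) * N ^ N ≤
      (N + 1) * (N.factorial * a ^ a * d ^ d) := by exact_mod_cast this
    have h3 : (a / N : ℝ) ^ a * (d / N : ℝ) ^ d = a ^ a * d ^ d / N ^ N := by
      rw [div_pow, div_pow, div_mul_div_comm, ← pow_add, had]
    rw [h3, ← mul_div_assoc, le_div_iff₀ (by positivity)]
    push_cast
    linarith
  rw [Fintype.card_perm, ← hN]
  calc (#{σ : Equiv.Perm (J × Fin t) | BlocksBichromatic (c ∘ σ)} : ℝ)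
      ≤ #Q * ((a.factorial * d.factorial : ℕ) : ℝ) := by exact_mod_cast hcount
    _ ≤ #Q * ((N + 1) * N.factorial * ((a / N : ℝ) ^ a * (d / N : ℝ) ^ d)) :=
        mul_le_mul_of_nonneg_left hmode (Nat.cast_nonneg _)
    _ = (N + 1) * N.factorial * (#Q * ((a / N : ℝ) ^ a * (d / N : ℝ) ^ d)) := by ring
    _ ≤ (N + 1) * N.factorial * (1 - 1 / 2 ^ (t - 1)) ^ Fintype.card J :=
        mul_le_mul_of_nonneg_left hweight (by positivity)
    _ = _ := by ring

/-! ### Conflict-free blocks and classes -/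

open Classical in
-- Greedy: the neighbours of a point block at most D of the D+1 colours.
theorem exists_proper_coloring_of_degree_le {J : Type*} [Fintype J] (R : J → J → Prop)
    (hsymm : ∀ x y, R x y → R y x) (D : ℕ) (hD : ∀ x, #{y | R x y} ≤ D) :
    ∃ κ : J → Fin (D + 1), ∀ x y, x ≠ y → R x y → κ x ≠ κ y := by
  suffices h : ∀ S : Finset J, ∃ κ : J → Fin (D + 1),
      ∀ x ∈ S, ∀ y ∈ S, x ≠ y → R x y → κ x ≠ κ y by
    obtain ⟨κ, hκ⟩ := h Finset.univ
    exact ⟨κ, fun x y => hκ x (Finset.mem_univ _) y (Finset.mem_univ _)⟩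
  intro S
  induction S using Finset.induction_on with
  | empty => exact ⟨fun _ => 0, by simp⟩
  | insert j S hj ih =>
    obtain ⟨κ, hκ⟩ := ih
    obtain ⟨k, hk⟩ : ∃ k : Fin (D + 1), k ∉ Finset.image κ {y | R j y} := by
      by_contra! h
      have h1 : (Finset.univ : Finset (Fin (D + 1))) ⊆ Finset.image κ {y | R j y} :=
        fun k _ => h k
      have h2 := (Finset.card_le_card h1).trans (Finset.card_image_le.trans (hD j))
      simp at h2
    have hk' : ∀ y, R j y → κ y ≠ k := by
      intro y hy h
      exact hk (Finset.mem_image.mpr ⟨y, by simpa using hy, h⟩)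
    refine ⟨Function.update κ j k, fun x hx y hy hxy hR => ?_⟩
    rcases Finset.mem_insert.mp hx with rfl | hxS
    · rw [Function.update_self, Function.update_of_ne hxy.symm]
      exact (hk' y hR).symm
    · have hxj : x ≠ j := fun h => hj (h ▸ hxS)
      rw [Function.update_of_ne hxj]
      rcases Finset.mem_insert.mp hy with rfl | hyS
      · rw [Function.update_self]
        exact hk' x (hsymm _ _ hR)
      · have hyj : y ≠ j := fun h => hj (h ▸ hyS)
        rw [Function.update_of_ne hyj]
        exact hκ x hxS y hyS hxy hR

open Classical in
theorem card_block {X J : Type*} [Fintype X] {t : ℕ} (e : X ≃ J × Fin t) (j : J) :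
    #{y | (e y).1 = j} = t := by
  have : ({y | (e y).1 = j} : Finset X) = Finset.univ.image fun s : Fin t => e.symm (j, s) := by
    ext y
    simp only [Finset.mem_filter, Finset.mem_univ, true_and, Finset.mem_image]
    constructor
    · rintro rfl
      exact ⟨(e y).2, by simp⟩
    · rintro ⟨s, rfl⟩
      simp
  rw [this, Finset.card_image_of_injective, Finset.card_univ, Fintype.card_fin]
  intro s s' h
  simpa using h

open Classical in
/-- A relation of bounded degree on a large set admits a partition into independent blocks. -/
theorem exists_equiv_independent_blocks {X J : Type*} [Fintype X] {t D : ℕ}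
    (e₀ : X ≃ J × Fin t) (B : X → X → Prop) (hsymm : ∀ x y, B x y → B y x)
    (hD : ∀ x, #{y | B x y} ≤ D) (hX : t + t * D + t * D < Fintype.card X) :
    ∃ e : X ≃ J × Fin t, ∀ x y, x ≠ y → (e x).1 = (e y).1 → ¬ B x y := by
  let bad : (X ≃ J × Fin t) → Finset (X × X) := fun e =>
    {p | p.1 ≠ p.2 ∧ (e p.1).1 = (e p.2).1 ∧ B p.1 p.2}
  have hbad : ∀ e x y, (x, y) ∈ bad e ↔ x ≠ y ∧ (e x).1 = (e y).1 ∧ B x y := by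
    intro e x y; simp [bad]
  -- Minimise the number of related pairs inside blocks; if one remains, a swap lowers the number.
  obtain ⟨e, he⟩ : ∃ e : X ≃ J × Fin t, ∀ e', #(bad e) ≤ #(bad e') := by
    obtain ⟨e, -, he⟩ := WellFounded.has_min (measure fun e => #(bad e)).wf Set.univ ⟨e₀, trivial⟩
    exact ⟨e, fun e' => not_lt.mp (he e' trivial)⟩
  refine ⟨e, fun x y hxy hblock hB => ?_⟩
  -- A partner for `x` must avoid its block (t points), the blocks meeting its neighbours (tD), and
  -- the neighbours of its block (tD): hence `hX`.
  obtain ⟨x', hx'1, hx'2, hx'3⟩ : ∃ x', (e x').1 ≠ (e x).1 ∧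
      (∀ v, (e v).1 = (e x').1 → ¬ B x v) ∧ (∀ v, (e v).1 = (e x).1 → ¬ B x' v) := by
    by_contra! h
    have hcov : (Finset.univ : Finset X) ⊆
        (({z | (e z).1 = (e x).1} : Finset X) ∪
          ({v | B x v} : Finset X).biUnion (fun v => {z | (e z).1 = (e v).1})) ∪
          ({v | (e v).1 = (e x).1} : Finset X).biUnion (fun v => {z | B v z}) := by
      intro z _
      simp only [Finset.mem_union, Finset.mem_filter, Finset.mem_univ, true_and,
        Finset.mem_biUnion]
      by_contra! hz
      obtain ⟨v, hv, hBv⟩ := h z hz.1.1 (fun v hv hBv => hz.1.2 v hBv hv.symm)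
      exact hz.2 v hv (hsymm _ _ hBv)
    have h1 := Finset.card_le_card hcov
    rw [Finset.card_univ] at h1
    have h2 := (Finset.card_union_le _ _).trans (add_le_add_left (Finset.card_union_le
      ({z | (e z).1 = (e x).1} : Finset X)
      (({v | B x v} : Finset X).biUnion (fun v => {z | (e z).1 = (e v).1})))
      (#(({v | (e v).1 = (e x).1} : Finset X).biUnion (fun v => {z | B v z}))))
    have h3 : #(({v | B x v} : Finset X).biUnion (fun v => {z | (e z).1 = (e v).1})) ≤ t * D := by
      refine (Finset.card_biUnion_le_card_mul _ _ t fun v _ => (card_block e _).le).trans ?_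
      rw [mul_comm]
      exact Nat.mul_le_mul_left _ (hD x)
    have h4 : #(({v | (e v).1 = (e x).1} : Finset X).biUnion (fun v => {z | B v z})) ≤ t * D := by
      refine (Finset.card_biUnion_le_card_mul _ _ D fun v _ => hD v).trans ?_
      rw [card_block]
    have h5 := card_block e (e x).1
    omega
  have hxx' : x ≠ x' := fun h => hx'1 (h ▸ rfl)
  set e' : X ≃ J × Fin t := (Equiv.swap x x').trans e with he'
  have hex : e' x = e x' := by simp [he']
  have hex' : e' x' = e x := by simp [he']
  have heo : ∀ z, z ≠ x → z ≠ x' → e' z = e z := by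
    intro z h1 h2
    simp [he', Equiv.swap_apply_of_ne_of_ne h1 h2]
  have key : ∀ u v, (u, v) ∈ bad e' → (u, v) ∈ bad e ∧ (u, v) ≠ (x, y) := by
    intro u v huv
    rw [hbad] at huv ⊢
    obtain ⟨hne, hbl, hBuv⟩ := huv
    rcases eq_or_ne u x with rfl | hux
    · exfalso
      rw [hex] at hbl
      rcases eq_or_ne v x' with rfl | hvx'
      · rw [hex'] at hbl; exact hx'1 hbl
      · rw [heo v hne.symm hvx'] at hbl
        exact hx'2 v hbl.symm hBuv
    · rcases eq_or_ne u x' with rfl | hux'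
      · exfalso
        rw [hex'] at hbl
        rcases eq_or_ne v x with rfl | hvx
        · rw [hex] at hbl; exact hx'1 hbl.symm
        · rw [heo v hvx hne.symm] at hbl
          exact hx'3 v hbl.symm hBuv
      · rw [heo u hux hux'] at hbl
        have hvx : v ≠ x := by
          rintro rfl
          rw [hex] at hbl
          exact hx'2 u hbl (hsymm _ _ hBuv)
        have hvx' : v ≠ x' := by
          rintro rfl
          rw [hex'] at hbl
          exact hx'3 u hbl (hsymm _ _ hBuv)
        rw [heo v hvx hvx'] at hbl
        exact ⟨⟨hne, hbl, hBuv⟩, fun h => hux (Prod.ext_iff.mp h).1⟩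
  have hss : bad e' ⊂ bad e := by
    refine Finset.ssubset_iff_subset_ne.mpr ⟨fun p hp => (key p.1 p.2 hp).1, fun h => ?_⟩
    have : (x, y) ∈ bad e' := by rw [h, hbad]; exact ⟨hxy, hblock, hB⟩
    exact (key x y this).2 rfl
  exact absurd (Finset.card_lt_card hss) (not_lt.mpr (he e'))

open Classical in
/-- A large set can be partitioned into blocks of size `t`, and the blocks into boundedly many
classes, so that each class is independent for a given relation of bounded degree. -/
theorem exists_equiv_independent_classes {X J : Type*} [Fintype X] [Fintype J] {t D : ℕ}
    (e₀ : X ≃ J × Fin t) (B : X → X → Prop) (hsymm : ∀ x y, B x y → B y x)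
    (hD : ∀ x, #{y | B x y} ≤ D) (hX : t + t * D + t * D < Fintype.card X) :
    ∃ (e : X ≃ J × Fin t) (κ : J → Fin (t * D + 1)),
      ∀ x y, x ≠ y → κ (e x).1 = κ (e y).1 → ¬ B x y := by
  obtain ⟨e, he⟩ := exists_equiv_independent_blocks e₀ B hsymm hD hX
  -- Contract blocks to points: a block is related to at most tD blocks, so tD+1 colours suffice.
  obtain ⟨R, hR⟩ : ∃ R : J → J → Prop,
      ∀ j j', R j j' ↔ ∃ x y, (e x).1 = j ∧ (e y).1 = j' ∧ B x y := ⟨_, fun _ _ => Iff.rfl⟩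
  obtain ⟨κ, hκ⟩ := exists_proper_coloring_of_degree_le R
    (fun j j' h => by
      obtain ⟨x, y, hx, hy, h⟩ := (hR _ _).mp h
      exact (hR _ _).mpr ⟨y, x, hy, hx, hsymm _ _ h⟩) (t * D) (by
      intro j
      have hsub : ({j' | R j j'} : Finset J) ⊆
          (({v | (e v).1 = j} : Finset X).biUnion (fun v => {z | B v z})).image
            (fun z => (e z).1) := by
        intro j' hj'
        simp only [Finset.mem_filter, Finset.mem_univ, true_and, hR] at hj'
        obtain ⟨x, y, hx, hy, h⟩ := hj'
        simp only [Finset.mem_image, Finset.mem_biUnion, Finset.mem_filter, Finset.mem_univ,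
          true_and]
        exact ⟨y, ⟨x, hx, h⟩, hy⟩
      refine (Finset.card_le_card hsub).trans (Finset.card_image_le.trans ?_)
      refine (Finset.card_biUnion_le_card_mul _ _ D fun v _ => hD v).trans ?_
      rw [card_block])
  refine ⟨e, κ, fun x y hxy hk hB => ?_⟩
  by_cases hb : (e x).1 = (e y).1
  · exact he x y hxy hb hB
  · exact hκ _ _ hb ((hR _ _).mpr ⟨x, y, rfl, rfl, hB⟩) hk

/-! ### Choosing the partitions -/

open Classical in
/-- Rearranging the blocks at random inside each class of a partition, one finds a block map `b`
that is bichromatic for only an exponentially small proportion of the colourings in `S`. -/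
theorem exists_block_map {X J : Type*} [Fintype X] [Fintype J] {t L : ℕ} (ht : 1 ≤ t)
    (e : X ≃ J × Fin t) (κ : J → Fin L) (S : Finset (X → Bool)) :
    ∃ b : X → J, (∀ j, #{x | b x = j} = t) ∧
      (∀ x y, b x = b y → κ (e x).1 = κ (e y).1) ∧
      (#{c ∈ S | ∀ j, ∃ x y, b x = j ∧ b y = j ∧ c x ≠ c y} : ℝ) ≤
        ((Fintype.card X + 1) ^ L * (1 - 1 / 2 ^ (t - 1)) ^ Fintype.card J) * #S := by
  -- One permutation per class, chosen independently; the new block j is the image of the old one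
  -- under the permutation of its class.
  let G := ∀ k : Fin L, Equiv.Perm ({j // κ j = k} × Fin t)
  let P : ∀ k : Fin L, {j // κ j = k} × Fin t → X := fun k y => e.symm (y.1.1, y.2)
  let f : G → X → J := fun τ x =>
    ((τ (κ (e x).1)).symm (⟨(e x).1, rfl⟩, (e x).2)).1.val
  have hP : ∀ x, ∃ k y, x = P k y := fun x =>
    ⟨κ (e x).1, (⟨(e x).1, rfl⟩, (e x).2), by simp [P]⟩
  have hPinj : ∀ k, Function.Injective (P k) := by
    intro k y y' h
    simp only [P, EmbeddingLike.apply_eq_iff_eq, Prod.mk.injEq] at h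
    exact Prod.ext (Subtype.ext h.1) h.2
  have hfP : ∀ τ k y, f τ (P k y) = ((τ k).symm y).1.1 := by
    rintro τ k ⟨⟨j, rfl⟩, s⟩
    have : ∀ z : J × Fin t, z = (j, s) → ((τ (κ z.1)).symm (⟨z.1, rfl⟩, z.2)).1.val =
        ((τ (κ j)).symm (⟨j, rfl⟩, s)).1.1 := by
      rintro _ rfl; rfl
    exact this _ (e.apply_symm_apply _)
  have hfib : ∀ τ j x, f τ x = j ↔ ∃ s, x = P (κ j) (τ (κ j) (⟨j, rfl⟩, s)) := by
    intro τ j x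
    constructor
    · obtain ⟨k, y, rfl⟩ := hP x
      rw [hfP]
      rintro rfl
      have hk := ((τ k).symm y).1.2
      refine ⟨((τ k).symm y).2, ?_⟩
      have : ∀ k' (h : κ ((τ k).symm y).1.1 = k'), k = k' →
          P k y = P k' (τ k' (⟨((τ k).symm y).1.1, h⟩, ((τ k).symm y).2)) := by
        rintro _ h rfl
        congr 1
        exact ((τ k).apply_symm_apply y).symm
      exact this _ rfl hk.symm
    · rintro ⟨s, rfl⟩
      rw [hfP, Equiv.symm_apply_apply]
  have hκ : ∀ τ x, κ (f τ x) = κ (e x).1 := fun τ x =>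
    ((τ (κ (e x).1)).symm (⟨(e x).1, rfl⟩, (e x).2)).1.2
  have hcard : ∀ τ j, #{x | f τ x = j} = t := by
    intro τ j
    have : ({x | f τ x = j} : Finset X) =
        Finset.univ.image fun s => P (κ j) (τ (κ j) (⟨j, rfl⟩, s)) := by
      ext x
      simp only [Finset.mem_filter, Finset.mem_univ, true_and, Finset.mem_image, hfib]
      exact exists_congr fun s => eq_comm
    rw [this, Finset.card_image_of_injective, Finset.card_univ, Fintype.card_fin]
    intro s s' h
    simpa using hPinj _ h
  let good : (X → Bool) → G → Prop := fun c τ =>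
    ∀ j, ∃ x y, f τ x = j ∧ f τ y = j ∧ c x ≠ c y
  have hq : (0 : ℝ) ≤ 1 - 1 / 2 ^ (t - 1) := by
    rw [sub_nonneg, div_le_one (by positivity)]
    exact one_le_pow₀ (by norm_num)
  set ρ : ℝ := (Fintype.card X + 1) ^ L * (1 - 1 / 2 ^ (t - 1)) ^ Fintype.card J with hρ
  have hprob : ∀ c, (#{τ : G | good c τ} : ℝ) ≤ ρ * Fintype.card G := by
    intro c
    -- The event factors over classes: the L polynomial factors multiply, and the exponents add up
    -- to the number of blocks.
    have hsub : ({τ : G | good c τ} : Finset G) ⊆ Fintype.piFinset fun k =>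
        {σ : Equiv.Perm ({j // κ j = k} × Fin t) | BlocksBichromatic ((c ∘ P k) ∘ σ)} := by
      intro τ hτ
      rw [Fintype.mem_piFinset]
      intro k
      simp only [Finset.mem_filter, Finset.mem_univ, true_and] at hτ ⊢
      rintro ⟨j, rfl⟩
      obtain ⟨x, y, hx, hy, hc⟩ := hτ j
      obtain ⟨s, rfl⟩ := (hfib _ _ _).mp hx
      obtain ⟨s', rfl⟩ := (hfib _ _ _).mp hy
      exact ⟨s, s', hc⟩
    have hJ : ∑ k, Fintype.card {j // κ j = k} = Fintype.card J := by
      rw [← Fintype.card_sigma]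
      exact Fintype.card_congr (Equiv.sigmaFiberEquiv κ)
    calc (#{τ : G | good c τ} : ℝ)
        ≤ ((∏ k, #{σ : Equiv.Perm ({j // κ j = k} × Fin t) |
            BlocksBichromatic ((c ∘ P k) ∘ σ)} : ℕ) : ℝ) := by
          rw [← Fintype.card_piFinset]
          exact_mod_cast Finset.card_le_card hsub
      _ ≤ ∏ k, (Fintype.card X + 1 : ℝ) * (1 - 1 / 2 ^ (t - 1)) ^ Fintype.card {j // κ j = k} *
            Fintype.card (Equiv.Perm ({j // κ j = k} × Fin t)) := by
          rw [Nat.cast_prod]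
          refine Finset.prod_le_prod (fun k _ => Nat.cast_nonneg _) fun k _ => ?_
          refine (card_perm_blocksBichromatic_le ht (c ∘ P k)).trans ?_
          have : (Fintype.card ({j // κ j = k} × Fin t) : ℝ) ≤ Fintype.card X := by
            exact_mod_cast Fintype.card_le_of_injective _ (hPinj k)
          refine mul_le_mul_of_nonneg_right ?_ (Nat.cast_nonneg _)
          refine mul_le_mul_of_nonneg_right ?_ (pow_nonneg hq _)
          linarith
      _ = ρ * Fintype.card G := by
          rw [Finset.prod_mul_distrib, Finset.prod_mul_distrib, Finset.prod_const,
            Finset.prod_pow_eq_pow_sum, hJ, Finset.card_univ, Fintype.card_fin, Fintype.card_pi,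
            Nat.cast_prod]
  -- Double counting: on average over `τ`, at most a share `ρ` of `S` survives, so some `τ` does as
  -- well.
  have hsum : ∑ τ : G, (#{c ∈ S | good c τ} : ℝ) ≤ ∑ _τ : G, ρ * #S := by
    have hswap : ∑ τ : G, (#{c ∈ S | good c τ} : ℝ) = ∑ c ∈ S, (#{τ : G | good c τ} : ℝ) := by
      exact_mod_cast (Finset.sum_card_bipartiteAbove_eq_sum_card_bipartiteBelow
        (s := (Finset.univ : Finset G)) (t := S) (fun τ c => good c τ))
    rw [hswap, Finset.sum_const, Finset.card_univ, nsmul_eq_mul]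
    calc ∑ c ∈ S, (#{τ : G | good c τ} : ℝ) ≤ ∑ _c ∈ S, ρ * Fintype.card G :=
          Finset.sum_le_sum fun c _ => hprob c
      _ = _ := by rw [Finset.sum_const, nsmul_eq_mul]; ring
  obtain ⟨τ, -, hτ⟩ := Finset.exists_le_of_sum_le ⟨1, Finset.mem_univ _⟩ hsum
  exact ⟨f τ, hcard τ, fun x y h => by rw [← hκ τ x, h, hκ], hτ⟩

open Classical in
/-- Block maps `b 0, …, b (s - 1)`, all with blocks of size `t`, such that two points of a block of
`b i` are never joined by a path through two blocks of earlier maps. -/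
structure IsBlockSystem {X J : Type*} [Fintype X] (b : ℕ → X → J) (t s : ℕ) : Prop where
  card_block : ∀ i < s, ∀ j, #{x | b i x = j} = t
  no_path : ∀ i < s, ∀ i₁ < i, ∀ i₂ < i, ∀ x y z, x ≠ y → b i x = b i y →
    b i₁ x = b i₁ z → b i₂ z ≠ b i₂ y

namespace IsBlockSystem

variable {X J : Type*} [Fintype X] {b : ℕ → X → J} {t s : ℕ}

/-- Apply `no_path` at the later map, with the degenerate path z = x. -/
theorem no_two_cycle (hb : IsBlockSystem b t s) {i i' : ℕ} (hi : i < s) (hi' : i' < s)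
    (hne : i ≠ i') {x y : X} (hxy : x ≠ y) (h : b i x = b i y) : b i' x ≠ b i' y := by
  intro h'
  rcases lt_or_gt_of_ne hne with hlt | hlt
  · exact hb.no_path i' hi' i hlt i hlt x y x hxy h' rfl h
  · exact hb.no_path i hi i' hlt i' hlt x y x hxy h rfl h'

/-- The block of the latest map closes a path through the two earlier ones. -/
theorem no_three_cycle (hb : IsBlockSystem b t s) {i j k : ℕ} (hi : i < s) (hj : j < s)
    (hk : k < s) (hij : i ≠ j) (hjk : j ≠ k) (hik : i ≠ k) {x y z : X} (hxy : x ≠ y)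
    (hyz : y ≠ z) (hxz : x ≠ z) (h₁ : b i x = b i y) (h₂ : b j y = b j z) : b k z ≠ b k x := by
  intro h₃
  have h : (j < i ∧ k < i) ∨ (i < j ∧ k < j) ∨ (i < k ∧ j < k) := by omega
  rcases h with ⟨h, h'⟩ | ⟨h, h'⟩ | ⟨h, h'⟩
  · exact hb.no_path i hi j h k h' y x z hxy.symm h₁.symm h₂ h₃
  · exact hb.no_path j hj k h' i h z y x hyz.symm h₂.symm h₃ h₁
  · exact hb.no_path k hk i h j h' x z y hxz h₃.symm h₁ h₂

end IsBlockSystem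

open Classical in
theorem exists_isBlockSystem {X J : Type*} [Fintype X] [Fintype J] {t r : ℕ} (ht : 1 ≤ t)
    (e₀ : X ≃ J × Fin t)
    (hX : t + t * (r * t * (r * t)) + t * (r * t * (r * t)) < Fintype.card X) (s : ℕ)
    (hs : s ≤ r) :
    ∃ b : ℕ → X → J, IsBlockSystem b t s ∧
      (#{c : X → Bool | ∀ i < s, ∀ j, ∃ x y, b i x = j ∧ b i y = j ∧ c x ≠ c y} : ℝ) ≤
        ((Fintype.card X + 1) ^ (t * (r * t * (r * t)) + 1) *
          (1 - 1 / 2 ^ (t - 1)) ^ Fintype.card J) ^ s * 2 ^ Fintype.card X := by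
  induction s with
  | zero =>
    refine ⟨fun _ x => (e₀ x).1, ⟨by simp, by simp⟩, ?_⟩
    simp
  | succ s ih =>
    obtain ⟨b, hb, hcount⟩ := ih (by omega)
    set ρ : ℝ := (Fintype.card X + 1) ^ (t * (r * t * (r * t)) + 1) *
          (1 - 1 / 2 ^ (t - 1)) ^ Fintype.card J with hρ
    have hρ0 : 0 ≤ ρ := by
      have : (0 : ℝ) ≤ 1 - 1 / 2 ^ (t - 1) := by
        rw [sub_nonneg, div_le_one (by positivity)]
        exact one_le_pow₀ (by norm_num)
      positivity
    obtain ⟨A, hA⟩ : ∃ A : X → X → Prop, ∀ x y, A x y ↔ ∃ i < s, b i x = b i y :=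
      ⟨_, fun _ _ => Iff.rfl⟩
    -- `A` has degree at most rt and `B` at most (rt)^2, whatever s ≤ r is, so the number of classes
    -- stays the same at every step.
    obtain ⟨B, hB⟩ : ∃ B : X → X → Prop, ∀ x y, B x y ↔ ∃ z, A x z ∧ A z y :=
      ⟨_, fun _ _ => Iff.rfl⟩
    have hAsymm : ∀ x y, A x y → A y x := by
      intro x y h
      obtain ⟨i, hi, h⟩ := (hA _ _).mp h
      exact (hA _ _).mpr ⟨i, hi, h.symm⟩
    have hBsymm : ∀ x y, B x y → B y x := by
      intro x y h
      obtain ⟨z, h1, h2⟩ := (hB _ _).mp h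
      exact (hB _ _).mpr ⟨z, hAsymm _ _ h2, hAsymm _ _ h1⟩
    have hAD : ∀ x, #{y | A x y} ≤ r * t := by
      intro x
      have hsub : ({y | A x y} : Finset X) ⊆
          (Finset.range s).biUnion fun i => {y | b i y = b i x} := by
        intro y hy
        simp only [Finset.mem_filter, Finset.mem_univ, true_and, hA] at hy
        obtain ⟨i, hi, h⟩ := hy
        simp only [Finset.mem_biUnion, Finset.mem_range, Finset.mem_filter, Finset.mem_univ,
          true_and]
        exact ⟨i, hi, h.symm⟩
      refine (Finset.card_le_card hsub).trans ((Finset.card_biUnion_le_card_mul _ _ t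
        fun i hi => (hb.card_block i (Finset.mem_range.mp hi) _).le).trans ?_)
      rw [Finset.card_range]
      exact Nat.mul_le_mul_right _ (by omega)
    have hBD : ∀ x, #{y | B x y} ≤ r * t * (r * t) := by
      intro x
      have hsub : ({y | B x y} : Finset X) ⊆
          ({z | A x z} : Finset X).biUnion fun z => {y | A z y} := by
        intro y hy
        simpa [hB] using hy
      refine (Finset.card_le_card hsub).trans ((Finset.card_biUnion_le_card_mul _ _ (r * t)
        fun z _ => hAD z).trans ?_)
      exact Nat.mul_le_mul_right _ (hAD x)
    obtain ⟨e, κ, hκ⟩ := exists_equiv_independent_classes e₀ B hBsymm hBD hX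
    obtain ⟨β, hβ1, hβ2, hβ3⟩ := exists_block_map ht e κ
      {c : X → Bool | ∀ i < s, ∀ j, ∃ x y, b i x = j ∧ b i y = j ∧ c x ≠ c y}
    have hold : ∀ i < s, Function.update b s β i = b i := fun i hi =>
      Function.update_of_ne hi.ne _ _
    have hnew : Function.update b s β s = β := Function.update_self _ _ _
    refine ⟨Function.update b s β, ⟨?_, ?_⟩, ?_⟩
    · intro i hi j
      rcases Nat.lt_succ_iff_lt_or_eq.mp hi with hi | rfl
      · rw [hold i hi]; exact hb.card_block i hi j
      · rw [hnew]; exact hβ1 j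
    · intro i hi i₁ hi₁ i₂ hi₂ x y z hxy
      rcases Nat.lt_succ_iff_lt_or_eq.mp hi with hi | rfl
      · rw [hold i hi, hold i₁ (hi₁.trans hi), hold i₂ (hi₂.trans hi)]
        exact hb.no_path i hi i₁ hi₁ i₂ hi₂ x y z hxy
      · rw [hnew, hold i₁ hi₁, hold i₂ hi₂]
        intro h h1 h2
        exact hκ x y hxy (hβ2 x y h) ((hB _ _).mpr
          ⟨z, (hA _ _).mpr ⟨i₁, hi₁, h1⟩, (hA _ _).mpr ⟨i₂, hi₂, h2⟩⟩)
    · calc _ ≤ _ := ?_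
        _ ≤ _ := hβ3
        _ ≤ ρ * (ρ ^ s * 2 ^ Fintype.card X) := mul_le_mul_of_nonneg_left hcount hρ0
        _ = _ := by ring
      refine Nat.cast_le.mpr (Finset.card_le_card ?_)
      intro c hc
      simp only [Finset.mem_filter, Finset.mem_univ, true_and] at hc ⊢
      refine ⟨fun i hi j => ?_, fun j => ?_⟩
      · have := hc i (by omega) j
        rwa [hold i hi] at this
      · have := hc s (by omega) j
        rwa [hnew] at this

/-! ### Numerical estimates -/

/-- The base of the exponential bound on the expected number of bichromatic colourings. -/
theorem two_pow_mul_one_sub_pow_lt_one {t r : ℕ} (ht : 1 ≤ t)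
    (hr : (t : ℝ) * 2 ^ (t - 1) * Real.log 2 ≤ r) :
    (2 : ℝ) ^ t * (1 - 1 / 2 ^ (t - 1)) ^ r < 1 := by
  have hlog : 0 < Real.log 2 := Real.log_pos (by norm_num)
  have ht' : (0 : ℝ) < t := by exact_mod_cast ht
  have hr0 : r ≠ 0 := by
    rintro rfl
    have : 0 < (t : ℝ) * 2 ^ (t - 1) * Real.log 2 := by positivity
    simp only [Nat.cast_zero] at hr
    linarith
  set q : ℝ := 1 / 2 ^ (t - 1) with hq
  have hq0 : 0 < q := by positivity
  have hq1 : q ≤ 1 := by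
    rw [hq, div_le_one (by positivity)]
    exact one_le_pow₀ (by norm_num)
  -- The only strict inequality: the hypothesis on `r` alone gives just exp(-qr) ≤ 2^(-t).
  have h1 : 1 - q < Real.exp (-q) := by
    have := Real.add_one_lt_exp (x := -q) (by linarith)
    linarith
  have h2 : (1 - q) ^ r < Real.exp (-q) ^ r := pow_lt_pow_left₀ h1 (by linarith) hr0
  have h3 : Real.exp (-q) ^ r ≤ Real.exp (-(t * Real.log 2)) := by
    rw [← Real.exp_nat_mul, Real.exp_le_exp]
    have : (t : ℝ) * Real.log 2 = q * (t * 2 ^ (t - 1) * Real.log 2) := by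
      rw [hq]; field_simp
    rw [this]
    nlinarith [mul_le_mul_of_nonneg_left hr hq0.le]
  have h4 : Real.exp (-(t * Real.log 2)) * 2 ^ t = 1 := by
    rw [Real.exp_neg, Real.exp_nat_mul, Real.exp_log (by norm_num)]
    exact inv_mul_cancel₀ (by positivity)
  calc (2 : ℝ) ^ t * (1 - q) ^ r < 2 ^ t * Real.exp (-(t * Real.log 2)) :=
        mul_lt_mul_of_pos_left (h2.trans_le h3) (by positivity)
    _ = 1 := by rw [mul_comm]; exact h4

open Filter Topology in
-- The quantity is at most a polynomial in m, of degree L * r independent of m, times θ^m with θ <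
-- 1.
theorem exists_pow_bound_lt_one {t r : ℕ} (ht : 1 ≤ t) (L M : ℕ)
    (hr : (t : ℝ) * 2 ^ (t - 1) * Real.log 2 ≤ r) :
    ∃ m : ℕ, M ≤ m ∧
      (((m * t : ℕ) + 1 : ℝ) ^ L * (1 - 1 / 2 ^ (t - 1)) ^ m) ^ r * 2 ^ (m * t) < 1 := by
  set q : ℝ := 1 / 2 ^ (t - 1) with hq
  have hq1 : (0 : ℝ) ≤ 1 - q := by
    rw [hq, sub_nonneg, div_le_one (by positivity)]
    exact one_le_pow₀ (by norm_num)
  set θ : ℝ := 2 ^ t * (1 - q) ^ r with hθ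
  have hθ1 : θ < 1 := two_pow_mul_one_sub_pow_lt_one ht hr
  have hθ0 : 0 ≤ θ := by positivity
  have hlim := (tendsto_pow_const_mul_const_pow_of_lt_one (L * r) hθ0 hθ1).const_mul
    (((t : ℝ) + 1) ^ (L * r))
  rw [mul_zero] at hlim
  have hev := ((hlim.eventually_lt_const one_pos).and (eventually_ge_atTop (max M 1))).exists
  obtain ⟨m, hm, hmM⟩ := hev
  have hm1 : 1 ≤ m := (le_max_right _ _).trans hmM
  refine ⟨m, (le_max_left _ _).trans hmM, lt_of_le_of_lt ?_ hm⟩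
  have hm1' : (1 : ℝ) ≤ m := by exact_mod_cast hm1
  calc (((m * t : ℕ) + 1 : ℝ) ^ L * (1 - q) ^ m) ^ r * 2 ^ (m * t)
      = ((m * t : ℕ) + 1 : ℝ) ^ (L * r) * θ ^ m := by
        rw [hθ, mul_pow, mul_pow, ← pow_mul, ← pow_mul, ← pow_mul, ← pow_mul, mul_comm t m,
          mul_comm r m]
        ring
    _ ≤ (((t : ℝ) + 1) * m) ^ (L * r) * θ ^ m := by
        refine mul_le_mul_of_nonneg_right (pow_le_pow_left₀ (by positivity) ?_ _) (by positivity)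
        push_cast
        nlinarith
    _ = _ := by rw [mul_pow]; ring

/-! ### The dual hypergraph -/

namespace MultiHypergraph

/-- The hypergraph dual to `r` block maps: its edges are the points, its vertices the blocks. -/
def ofBlockMaps {X J : Type*} (b : ℕ → X → J) (r : ℕ) : MultiHypergraph (Fin r × J) X where
  edge x := Finset.univ.map ⟨fun i : Fin r => (i, b i x), fun _ _ h => (Prod.ext_iff.mp h).1⟩

theorem mem_edge_ofBlockMaps {X J : Type*} (b : ℕ → X → J) (r : ℕ) (v : Fin r × J) (x : X) :
    v ∈ (ofBlockMaps b r).edge x ↔ b v.1 x = v.2 := by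
  obtain ⟨i, j⟩ := v
  simp only [ofBlockMaps, Finset.mem_map, Finset.mem_univ, true_and]
  constructor
  · rintro ⟨_, h⟩
    obtain ⟨rfl, h'⟩ := Prod.ext_iff.mp h
    exact h'
  · rintro rfl
    exact ⟨i, rfl⟩

theorem isUniform_ofBlockMaps {X J : Type*} (b : ℕ → X → J) (r : ℕ) :
    (ofBlockMaps b r).IsUniform r := by
  intro x
  simp [ofBlockMaps]

theorem isPartite_ofBlockMaps {X J : Type*} [Fintype J] (b : ℕ → X → J) (r : ℕ) :
    (ofBlockMaps b r).IsPartite r := by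
  classical
  refine ⟨fun i => {i} ×ˢ Finset.univ, fun i j hij => ?_, fun v => ⟨v.1, by simp⟩, fun x i => ?_⟩
  · rw [Finset.disjoint_left]
    intro v hv hv'
    simp only [Finset.mem_product, Finset.mem_singleton, Finset.mem_univ, and_true] at hv hv'
    exact hij (hv.symm.trans hv')
  · rw [Finset.card_le_one]
    intro v hv v' hv'
    simp only [Finset.mem_inter, mem_edge_ofBlockMaps, Finset.mem_product, Finset.mem_singleton,
      Finset.mem_univ, and_true] at hv hv'
    have h1 : v.1 = v'.1 := hv.2.trans hv'.2.symm
    exact Prod.ext h1 (by rw [← hv.1, ← hv'.1, h1])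

theorem isRegular_ofBlockMaps {X J : Type*} [Fintype X] {b : ℕ → X → J} {t r : ℕ}
    (hb : IsBlockSystem b t r) : (ofBlockMaps b r).IsRegular t := by
  classical
  intro v
  rw [degree, degreeIn, ← hb.card_block v.1 v.1.2 v.2]
  congr 1
  ext x
  simp [mem_edge_ofBlockMaps]

theorem four_le_girth_ofBlockMaps {X J : Type*} [Fintype X] {b : ℕ → X → J} {t r : ℕ}
    (hb : IsBlockSystem b t r) : 4 ≤ (ofBlockMaps b r).girth := by
  refine le_iInf₂ fun k hk => ?_
  obtain ⟨h2, v, e, hv, he, hlast, hinc⟩ := hk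
  by_contra hlt
  have hk4 : k < 4 := by
    by_contra h
    exact hlt (by exact_mod_cast not_lt.mp h)
  simp only [mem_edge_ofBlockMaps] at hinc
  -- Distinct vertices of one edge lie in different parts, so a short cycle uses blocks of pairwise
  -- different maps.
  have hcol : ∀ u w x, b u.1 x = u.2 → b w.1 x = w.2 → u ≠ w → (u : Fin r × J).1 ≠ w.1 := by
    intro u w x hu hw huw h
    exact huw (Prod.ext h (by rw [← hu, ← hw, h]))
  have hval : ∀ {i j : Fin r}, i ≠ j → (i : ℕ) ≠ j := fun h h' => h (Fin.ext h')
  interval_cases k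
  · have a0 := hinc 0
    have a1 := hinc 1
    have hv01 : v 0 ≠ v 1 := fun h => by simpa using hv (a₁ := 0) (a₂ := 1) h
    have he01 : e 0 ≠ e 1 := fun h => by simpa using he h
    have hl : v 2 = v 0 := hlast
    have b0 : b (v 0).1 (e 0) = (v 0).2 := a0.1
    have b1 : b (v 1).1 (e 0) = (v 1).2 := a0.2
    have c0 : b (v 1).1 (e 1) = (v 1).2 := a1.1
    have c1 : b (v 2).1 (e 1) = (v 2).2 := a1.2
    rw [hl] at c1
    exact hb.no_two_cycle (v 0).1.2 (v 1).1.2 (hval (hcol _ _ _ b0 b1 hv01)) he01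
      (b0.trans c1.symm) (b1.trans c0.symm)
  · have a0 := hinc 0
    have a1 := hinc 1
    have a2 := hinc 2
    have hv01 : v 0 ≠ v 1 := fun h => by simpa using hv (a₁ := 0) (a₂ := 1) h
    have hv12 : v 1 ≠ v 2 := fun h => by simpa using hv (a₁ := 1) (a₂ := 2) h
    have hv20 : v 2 ≠ v 0 := fun h => by simpa using hv (a₁ := 2) (a₂ := 0) h
    have he01 : e 0 ≠ e 1 := fun h => by simpa using he h
    have he12 : e 1 ≠ e 2 := fun h => by simpa using he h
    have he02 : e 0 ≠ e 2 := fun h => by simpa using he h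
    have hl : v 3 = v 0 := hlast
    have b0 : b (v 0).1 (e 0) = (v 0).2 := a0.1
    have b1 : b (v 1).1 (e 0) = (v 1).2 := a0.2
    have c0 : b (v 1).1 (e 1) = (v 1).2 := a1.1
    have c1 : b (v 2).1 (e 1) = (v 2).2 := a1.2
    have d0 : b (v 2).1 (e 2) = (v 2).2 := a2.1
    have d1 : b (v 3).1 (e 2) = (v 3).2 := a2.2
    rw [hl] at d1
    exact hb.no_three_cycle (v 1).1.2 (v 2).1.2 (v 0).1.2 (hval (hcol _ _ _ c0 c1 hv12))
      (hval (hcol _ _ _ d0 d1 hv20)) (hval (hcol _ _ _ b0 b1 hv01)).symm he01 he12 he02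
      (b1.trans c0.symm) (c1.trans d0.symm) (d1.trans b0.symm)

open Classical in
/-- Every block has points both inside and outside a shallow hitting edge set. -/
theorem exists_mem_notMem_of_isShallow_of_isHitting {X J : Type*} [Fintype X]
    {b : ℕ → X → J} {t r : ℕ} (ht : 1 ≤ t) (hb : IsBlockSystem b t r) {M : Finset X}
    (hs : (ofBlockMaps b r).IsShallow (t - 1) M) (hh : (ofBlockMaps b r).IsHitting M)
    (i : ℕ) (hi : i < r) (j : J) :
    ∃ x y, b i x = j ∧ b i y = j ∧ x ∈ M ∧ y ∉ M := by
  have h1 := hh (⟨i, hi⟩, j)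
  have h2 := hs (⟨i, hi⟩, j)
  simp only [degreeIn, mem_edge_ofBlockMaps] at h1 h2
  obtain ⟨x, hx⟩ := Finset.card_pos.mp h1
  obtain ⟨hxM, hxj⟩ := Finset.mem_filter.mp hx
  obtain ⟨y, hyj, hyM⟩ : ∃ y, b i y = j ∧ y ∉ M := by
    by_contra! h
    have hsub : ({y | b i y = j} : Finset X) ⊆ M.filter fun y => b i y = j := by
      intro y hy
      have hy' : b i y = j := (Finset.mem_filter.mp hy).2
      exact Finset.mem_filter.mpr ⟨h y hy', hy'⟩
    have := Finset.card_le_card hsub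
    rw [hb.card_block i hi j] at this
    have := this.trans h2
    omega
  exact ⟨x, y, hxj, hyj, hxM, hyM⟩

end MultiHypergraph

/-! ### Conclusion -/

theorem mainTheorem11 (t r : ℕ) (ht : 2 ≤ t)
    (hr : r = ⌈(t : ℝ) * 2 ^ (t - 1) * Real.log 2⌉₊) :
    ∃ (V E : Type) (_ : Fintype V) (_ : Fintype E) (H : MultiHypergraph V E),
      H.IsUniform r ∧ H.IsPartite r ∧ H.IsRegular t ∧ 4 ≤ H.girth ∧
        ¬ ∃ M : Finset E, H.IsShallow (t - 1) M ∧ H.IsHitting M := by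
  classical
  have ht1 : 1 ≤ t := by omega
  -- With D = (rt)^2, the bound m ≥ 2D + 2 gives mt > t + 2tD, the room needed for the swaps.
  obtain ⟨m, hmM, hm⟩ := exists_pow_bound_lt_one ht1 (t * (r * t * (r * t)) + 1)
    (2 * (r * t * (r * t)) + 2) (r := r) (by rw [hr]; exact Nat.le_ceil _)
  have hX : t + t * (r * t * (r * t)) + t * (r * t * (r * t)) <
      Fintype.card (Fin m × Fin t) := by
    rw [Fintype.card_prod, Fintype.card_fin, Fintype.card_fin]
    have := Nat.mul_le_mul_right t hmM
    nlinarith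
  obtain ⟨b, hb, hcount⟩ := exists_isBlockSystem ht1 (Equiv.refl (Fin m × Fin t)) hX r le_rfl
  refine ⟨Fin r × Fin m, Fin m × Fin t, inferInstance, inferInstance,
    MultiHypergraph.ofBlockMaps b r, MultiHypergraph.isUniform_ofBlockMaps b r,
    MultiHypergraph.isPartite_ofBlockMaps b r, MultiHypergraph.isRegular_ofBlockMaps hb,
    MultiHypergraph.four_le_girth_ofBlockMaps hb, ?_⟩
  rintro ⟨M, hs, hh⟩
  -- The indicator of `M` would be a surviving colouring, but their number is below 1.
  have hmem : (fun x => decide (x ∈ M)) ∈ ({c : Fin m × Fin t → Bool | ∀ i < r, ∀ j,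
      ∃ x y, b i x = j ∧ b i y = j ∧ c x ≠ c y} : Finset _) :=
    Finset.mem_filter.mpr ⟨Finset.mem_univ _, fun i hi j => by
      obtain ⟨x, y, hx, hy, hxM, hyM⟩ :=
        MultiHypergraph.exists_mem_notMem_of_isShallow_of_isHitting ht1 hb hs hh i hi j
      exact ⟨x, y, hx, hy, by simp [hxM, hyM]⟩⟩
  have hpos : (1 : ℝ) ≤ #{c : Fin m × Fin t → Bool | ∀ i < r, ∀ j,
      ∃ x y, b i x = j ∧ b i y = j ∧ c x ≠ c y} := by
    exact_mod_cast Finset.card_pos.mpr ⟨_, hmem⟩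
  have hN : Fintype.card (Fin m × Fin t) = m * t := by simp
  rw [hN, Fintype.card_fin] at hcount
  have := hpos.trans (le_trans (by convert le_rfl) hcount)
  linarith
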